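/- Let $\mathcal K$ be a star-autonomous category, i.e. a linearly distributive category (in the sense of Cockett and Seely, not assumed symmetric) with monoidal structures $(\otimes,e)$ and $(⅋,d)$ and linear distributions $a\otimes(b⅋c)\to(a\otimes b)⅋c$ and $(a⅋b)\otimes c\to a⅋(b\otimes c)$, in which every object $p$ has a chosen right dual $p^{\perp}$, with unit $\tau:e\to p^{\perp}⅋p$ and counit $\gamma:p\otimes p^{\perp}\to d$, and a chosen left dual ${}^{\perp}p$, with unit $\tau:e\to p⅋{}^{\perp}p$ and counit $\gamma:{}^{\perp}p\otimes p\to d$, satisfying the triangle identities. Suppose that $\otimes$ carries a braiding $\beta_{p,q}:p\otimes q\to q\otimes p$, and let $\check\beta_{p,q}:p⅋q\to q⅋p$ be the braiding of $⅋$ induced by duality, whose right dual is, up to the de Morgan isomorphisms, $\beta_{p^{\perp},q^{\perp}}$. A natural isomorphism $\kappa_p:p^{\perp}\to{}^{\perp}p$ is called a $\otimes$-semicycle if, for all $p,q$, the arrow $\kappa_{p\otimes q}$ corresponds to $\kappa_q⅋\kappa_p$ under the de Morgan isomorphisms $(p\otimes q)^{\perp}\cong q^{\perp}⅋p^{\perp}$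 and ${}^{\perp}(p\otimes q)\cong{}^{\perp}q⅋{}^{\perp}p$; a $⅋$-semicycle if, for all $p,q$, the arrow $\kappa_{p⅋q}$ corresponds to $\kappa_q\otimes\kappa_p$ under $(p⅋q)^{\perp}\cong q^{\perp}\otimes p^{\perp}$ and ${}^{\perp}(p⅋q)\cong{}^{\perp}q\otimes{}^{\perp}p$; and a cycle if it is both. A natural isomorphism $\theta:\mathrm{Id}_{\mathcal K}\to\mathrm{Id}_{\mathcal K}$ is called a $\otimes$-semibalance if $\theta_{p\otimes q}=\beta_{q,p}\circ(\theta_q\otimes\theta_p)\circ\beta_{p,q}$ for all $p,q$; a $⅋$-semibalance if $\theta_{p⅋q}=\check\beta_{q,p}\circ(\theta_q⅋\theta_p)\circ\check\beta_{p,q}$ for all $p,q$; and a balance if it is both. Then there is a bijection $\Phi$ from the natural isomorphisms $\kappa:({-})^{\perp}\to{}^{\perp}({-})$ to the natural isomorphisms $\theta:\mathrm{Id}_{\mathcal K}\to\mathrm{Id}_{\mathcal K}$, given explicitly as follows. (a) $\Phi(\kappa)_p$ is the composite $$p\cong p\otimes e\xrightarrow{p\otimes\tau}p\otimes(p^{\perp}⅋p)\to(p\otimes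 p^{\perp})⅋p\xrightarrow{(p\otimes\kappa_p)⅋p}(p\otimes{}^{\perp}p)⅋p\xrightarrow{\beta_{{}^{\perp}p,p}^{-1}⅋p}({}^{\perp}p\otimes p)⅋p\xrightarrow{\gamma⅋p}d⅋p\cong p.$$ (b) If $\kappa=\Phi^{-1}(\theta)$ then, for every $\omega:p\otimes t\to d$ with transpose $\bar\omega:t\to p^{\perp}$, $$\gamma\circ\bigl((\kappa_p\circ\bar\omega)\otimes p\bigr)=\omega\circ(\theta_p\otimes t)\circ\beta_{t,p}:\;t\otimes p\to d.$$ Moreover, $\Phi$ restricts to bijections between $\otimes$-semicycles and $\otimes$-semibalances, between $⅋$-semicycles and $⅋$-semibalances, and between cycles and balances. -/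

import Mathlib

open CategoryTheory MonoidalCategory

universe v u

/-- A second monoidal structure `(⅋, d)` ("par") on a category.  It is wrapped in a class of its
own so that it does not compete with the monoidal structure `(⊗, 𝟙_ C)` ("tensor"), which is the
ordinary `MonoidalCategory` instance. -/
class ParMonoidal (C : Type u) [Category.{v} C] where
  /-- The monoidal structure given by par. -/
  mon : MonoidalCategory.{v} C

section Par

variable {C : Type u} [Category.{v} C] [ParMonoidal C]

/-- The object `a ⅋ b`. -/
abbrev parObj (a b : C) : C := ParMonoidal.mon.tensorObj a b

/-- The arrow `f ⅋ g`. -/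
abbrev parHom {a a' b b' : C} (f : a ⟶ a') (g : b ⟶ b') : parObj a b ⟶ parObj a' b' :=
  ParMonoidal.mon.tensorHom f g

/-- The arrow `id ⅋ f`. -/
abbrev parWhiskerLeft (a : C) {b b' : C} (f : b ⟶ b') : parObj a b ⟶ parObj a b' :=
  ParMonoidal.mon.whiskerLeft a f

/-- The arrow `f ⅋ id`. -/
abbrev parWhiskerRight {a a' : C} (f : a ⟶ a') (b : C) : parObj a b ⟶ parObj a' b :=
  ParMonoidal.mon.whiskerRight f b

variable (C) in
/-- The unit `d` of par. -/
abbrev parUnit : C := ParMonoidal.mon.tensorUnit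

/-- The associator `(a ⅋ b) ⅋ c ≅ a ⅋ (b ⅋ c)`. -/
abbrev parAssoc (a b c : C) : parObj (parObj a b) c ≅ parObj a (parObj b c) :=
  ParMonoidal.mon.associator a b c

/-- The left unitor `d ⅋ a ≅ a`. -/
abbrev parLeftUnitor (a : C) : parObj (parUnit C) a ≅ a := ParMonoidal.mon.leftUnitor a

/-- The right unitor `a ⅋ d ≅ a`. -/
abbrev parRightUnitor (a : C) : parObj a (parUnit C) ≅ a := ParMonoidal.mon.rightUnitor a

end Par

infixr:70 " ⅋ " => parObj
infixr:70 " ⅋ₘ " => parHom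
infixr:81 " ◁⅋ " => parWhiskerLeft
infixl:81 " ▷⅋ " => parWhiskerRight

/-- A (planar) linearly distributive category in the sense of Cockett and Seely: a category with
two monoidal structures, tensor and par, and natural linear distributions
`a ⊗ (b ⅋ c) ⟶ (a ⊗ b) ⅋ c` and `(a ⅋ b) ⊗ c ⟶ a ⅋ (b ⊗ c)`, subject to the usual ten coherence
axioms. -/
class LinearlyDistributive (C : Type u) [Category.{v} C] [MonoidalCategory C]
    [ParMonoidal C] where
  /-- The left linear distribution. -/
  distL : ∀ a b c : C, a ⊗ (b ⅋ c) ⟶ (a ⊗ b) ⅋ c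
  /-- The right linear distribution. -/
  distR : ∀ a b c : C, (a ⅋ b) ⊗ c ⟶ a ⅋ (b ⊗ c)
  distL_naturality : ∀ {a a' b b' c c' : C} (f : a ⟶ a') (g : b ⟶ b') (h : c ⟶ c'),
    (f ⊗ₘ (g ⅋ₘ h)) ≫ distL a' b' c' = distL a b c ≫ ((f ⊗ₘ g) ⅋ₘ h)
  distR_naturality : ∀ {a a' b b' c c' : C} (f : a ⟶ a') (g : b ⟶ b') (h : c ⟶ c'),
    ((f ⅋ₘ g) ⊗ₘ h) ≫ distR a' b' c' = distR a b c ≫ (f ⅋ₘ (g ⊗ₘ h))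
  -- compatibility with the units
  distL_leftUnitor : ∀ b c : C,
    distL (𝟙_ C) b c ≫ (λ_ b).hom ▷⅋ c = (λ_ (b ⅋ c)).hom
  distL_rightUnitor : ∀ a b : C,
    distL a b (parUnit C) ≫ (parRightUnitor (a ⊗ b)).hom = a ◁ (parRightUnitor b).hom
  distR_rightUnitor : ∀ a b : C,
    distR a b (𝟙_ C) ≫ a ◁⅋ (ρ_ b).hom = (ρ_ (a ⅋ b)).hom
  distR_leftUnitor : ∀ b c : C,
    distR (parUnit C) b c ≫ (parLeftUnitor (b ⊗ c)).hom = (parLeftUnitor b).hom ▷ c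
  -- compatibility of each distribution with the two associators
  distL_tensor : ∀ a b c k : C,
    distL (a ⊗ b) c k ≫ (α_ a b c).hom ▷⅋ k =
      (α_ a b (c ⅋ k)).hom ≫ a ◁ distL b c k ≫ distL a (b ⊗ c) k
  distL_par : ∀ a b c k : C,
    a ◁ (parAssoc b c k).hom ≫ distL a b (c ⅋ k) =
      distL a (b ⅋ c) k ≫ distL a b c ▷⅋ k ≫ (parAssoc (a ⊗ b) c k).hom
  distR_tensor : ∀ a b c k : C,
    (α_ (a ⅋ b) c k).hom ≫ distR a b (c ⊗ k) =
      distR a b c ▷ k ≫ distR a (b ⊗ c) k ≫ a ◁⅋ (α_ b c k).hom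
  distR_par : ∀ a b c k : C,
    distR (a ⅋ b) c k ≫ (parAssoc a b (c ⊗ k)).hom =
      (parAssoc a b c).hom ▷ k ≫ distR a (b ⅋ c) k ≫ a ◁⅋ distR b c k
  -- compatibility of the two distributions with each other
  dist_tensor : ∀ a b c k : C,
    distL a b c ▷ k ≫ distR (a ⊗ b) c k =
      (α_ a (b ⅋ c) k).hom ≫ a ◁ distR b c k ≫ distL a b (c ⊗ k)
  dist_par : ∀ a b c k : C,
    distL (a ⅋ b) c k ≫ distR a b c ▷⅋ k ≫ (parAssoc a (b ⊗ c) k).hom =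
      distR a b (c ⅋ k) ≫ a ◁⅋ distL b c k

section LinDist

open LinearlyDistributive

variable {C : Type u} [Category.{v} C] [MonoidalCategory C] [ParMonoidal C]
  [LinearlyDistributive C]

/-- The curried form `t ⟶ y` of `ω : x ⊗ t ⟶ d`, formed with `τ : 𝟙_ C ⟶ y ⅋ x`. -/
def lCurry {x y t : C} (τ : 𝟙_ C ⟶ y ⅋ x) (ω : x ⊗ t ⟶ parUnit C) : t ⟶ y :=
  (λ_ t).inv ≫ τ ▷ t ≫ distR y x t ≫ y ◁⅋ ω ≫ (parRightUnitor y).hom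

/-- The curried form `t ⟶ x` of `ψ : t ⊗ y ⟶ d`, formed with `τ : 𝟙_ C ⟶ y ⅋ x`. -/
def rCurry {x y t : C} (τ : 𝟙_ C ⟶ y ⅋ x) (ψ : t ⊗ y ⟶ parUnit C) : t ⟶ x :=
  (ρ_ t).inv ≫ t ◁ τ ≫ distL t y x ≫ ψ ▷⅋ x ≫ (parLeftUnitor x).hom

/-- Linear duality: `x` is a left dual of `y`, and `y` is a right dual of `x`. -/
structure LinearDual (x y : C) where
  /-- The unit `τ` of the duality. -/
  unit : 𝟙_ C ⟶ y ⅋ x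
  /-- The counit `γ` of the duality. -/
  counit : x ⊗ y ⟶ parUnit C
  /-- `x ⟶ x ⊗ 𝟙_ C ⟶ x ⊗ (y ⅋ x) ⟶ (x ⊗ y) ⅋ x ⟶ d ⅋ x ⟶ x` is the identity. -/
  triangle_left : rCurry unit counit = 𝟙 x
  /-- `y ⟶ 𝟙_ C ⊗ y ⟶ (y ⅋ x) ⊗ y ⟶ y ⅋ (x ⊗ y) ⟶ y ⅋ d ⟶ y` is the identity. -/
  triangle_right : lCurry unit counit = 𝟙 y

/-- The unit of the duality between `x ⊗ x'` and `y' ⅋ y` that is induced by units of dualities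
between `x`, `y` and between `x'`, `y'`. -/
def tensorCap {x y x' y' : C} (τ : 𝟙_ C ⟶ y ⅋ x) (τ' : 𝟙_ C ⟶ y' ⅋ x') :
    𝟙_ C ⟶ (y' ⅋ y) ⅋ (x ⊗ x') :=
  τ' ≫ y' ◁⅋ ((λ_ x').inv ≫ τ ▷ x' ≫ distR y x x') ≫ (parAssoc y' y (x ⊗ x')).inv

/-- The unit of the duality between `x ⅋ x'` and `y' ⊗ y` that is induced by units of dualities
between `x`, `y` and between `x'`, `y'`. -/
def parCap {x y x' y' : C} (τ : 𝟙_ C ⟶ y ⅋ x) (τ' : 𝟙_ C ⟶ y' ⅋ x') :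
    𝟙_ C ⟶ (y' ⊗ y) ⅋ (x ⅋ x') :=
  τ' ≫ ((ρ_ y').inv ≫ y' ◁ τ ≫ distL y' y x) ▷⅋ x' ≫ (parAssoc (y' ⊗ y) x x').hom

/-- The counit of the duality between `x ⅋ x'` and `y' ⊗ y` that is induced by counits of
dualities between `x`, `y` and between `x'`, `y'`. -/
def parCup {x y x' y' : C} (γ : x ⊗ y ⟶ parUnit C) (γ' : x' ⊗ y' ⟶ parUnit C) :
    (x ⅋ x') ⊗ (y' ⊗ y) ⟶ parUnit C :=
  (α_ (x ⅋ x') y' y).inv ≫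
    (distR x x' y' ≫ x ◁⅋ γ' ≫ (parRightUnitor x).hom) ▷ y ≫ γ

end LinDist

/-- A star-autonomous category: a linearly distributive category with a chosen right dual
`perp p` and a chosen left dual `prep p` of every object `p`. -/
class StarAutonomous (C : Type u) [Category.{v} C] [MonoidalCategory C] [ParMonoidal C]
    [LinearlyDistributive C] where
  /-- The chosen right dual. -/
  perp : C → C
  /-- `𝟙_ C ⟶ perp p ⅋ p` and `p ⊗ perp p ⟶ d`. -/
  perpDual : ∀ p : C, LinearDual p (perp p)
  /-- The chosen left dual. -/
  prep : C → C
  /-- `𝟙_ C ⟶ p ⅋ prep p` and `prep p ⊗ p ⟶ d`. -/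
  prepDual : ∀ p : C, LinearDual (prep p) p

section StarAut

open LinearlyDistributive StarAutonomous

variable {C : Type u} [Category.{v} C] [MonoidalCategory C] [ParMonoidal C]
  [LinearlyDistributive C] [StarAutonomous C]

/-- The action of the contravariant functor `perp` on arrows. -/
def perpMap {p q : C} (f : p ⟶ q) : perp q ⟶ perp p :=
  lCurry (perpDual p).unit (f ▷ perp q ≫ (perpDual q).counit)

/-- The action of the contravariant functor `prep` on arrows. -/
def prepMap {p q : C} (f : p ⟶ q) : prep q ⟶ prep p :=
  rCurry (prepDual p).unit (prep q ◁ f ≫ (prepDual q).counit)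

/-- The de Morgan arrow `perp (p ⊗ q) ⟶ perp q ⅋ perp p`. -/
def perpTensor (p q : C) : perp (p ⊗ q) ⟶ perp q ⅋ perp p :=
  lCurry (tensorCap (perpDual p).unit (perpDual q).unit) (perpDual (p ⊗ q)).counit

/-- The de Morgan arrow `prep (p ⊗ q) ⟶ prep q ⅋ prep p`. -/
def prepTensor (p q : C) : prep (p ⊗ q) ⟶ prep q ⅋ prep p :=
  rCurry (parCap (prepDual q).unit (prepDual p).unit) (prepDual (p ⊗ q)).counit

/-- The de Morgan arrow `perp (p ⅋ q) ⟶ perp q ⊗ perp p`. -/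
def perpPar (p q : C) : perp (p ⅋ q) ⟶ perp q ⊗ perp p :=
  lCurry (parCap (perpDual p).unit (perpDual q).unit) (perpDual (p ⅋ q)).counit

/-- The de Morgan arrow `prep (p ⅋ q) ⟶ prep q ⊗ prep p`. -/
def prepPar (p q : C) : prep (p ⅋ q) ⟶ prep q ⊗ prep p :=
  rCurry (tensorCap (prepDual q).unit (prepDual p).unit) (prepDual (p ⅋ q)).counit

variable (C) in
/-- A natural isomorphism from the right dual `perp p` to the left dual `prep p`. -/
@[ext]
structure DualIso where
  /-- The components. -/
  app : ∀ p : C, perp p ≅ prep p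
  naturality : ∀ {p q : C} (f : p ⟶ q),
    perpMap f ≫ (app p).hom = (app q).hom ≫ prepMap f

namespace DualIso

/-- The operation `Hom(p ⊗ t, d) → Hom(t ⊗ p, d)` that corresponds to `κ`: curry `ω` to an arrow
`t ⟶ perp p`, compose with `κ`, and uncurry. -/
def cyc (κ : DualIso C) {p t : C} (ω : p ⊗ t ⟶ parUnit C) : t ⊗ p ⟶ parUnit C :=
  (lCurry (perpDual p).unit ω ≫ (κ.app p).hom) ▷ p ≫ (prepDual p).counit

/-- `κ` is compatible with the de Morgan arrows for tensor. -/
def IsTensorSemicycle (κ : DualIso C) : Prop :=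
  ∀ p q : C, (κ.app (p ⊗ q)).hom ≫ prepTensor p q =
    perpTensor p q ≫ ((κ.app q).hom ⅋ₘ (κ.app p).hom)

/-- `κ` is compatible with the de Morgan arrows for par. -/
def IsParSemicycle (κ : DualIso C) : Prop :=
  ∀ p q : C, (κ.app (p ⅋ q)).hom ≫ prepPar p q =
    perpPar p q ≫ ((κ.app q).hom ⊗ₘ (κ.app p).hom)

/-- A cycle is both a tensor-semicycle and a par-semicycle. -/
def IsCycle (κ : DualIso C) : Prop :=
  κ.IsTensorSemicycle ∧ κ.IsParSemicycle

end DualIso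

section Braided

variable [BraidedCategory C]

/-- The braiding `p ⅋ q ⟶ q ⅋ p` for par that the braiding for tensor induces by duality: it is
the arrow whose right dual is, up to the de Morgan isomorphisms, the braiding
`perp p ⊗ perp q ⟶ perp q ⊗ perp p`. -/
def parBraiding (p q : C) : p ⅋ q ⟶ q ⅋ p :=
  rCurry
    (parCap (perpDual q).unit (perpDual p).unit ≫ (β_ (perp p) (perp q)).hom ▷⅋ (q ⅋ p))
    (parCup (perpDual p).counit (perpDual q).counit)

/-- `θ` is a balance for the braiding of tensor. -/
def IsTensorSemibalance (θ : 𝟭 C ≅ 𝟭 C) : Prop :=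
  ∀ p q : C, θ.hom.app (p ⊗ q) =
    (β_ p q).hom ≫ (θ.hom.app q ⊗ₘ θ.hom.app p) ≫ (β_ q p).hom

/-- `θ` is a balance for the braiding of par. -/
def IsParSemibalance (θ : 𝟭 C ≅ 𝟭 C) : Prop :=
  ∀ p q : C, θ.hom.app (p ⅋ q) =
    parBraiding p q ≫ (θ.hom.app q ⅋ₘ θ.hom.app p) ≫ parBraiding q p

/-- A balance is both a tensor-semibalance and a par-semibalance. -/
def IsBalance (θ : 𝟭 C ≅ 𝟭 C) : Prop :=
  IsTensorSemibalance θ ∧ IsParSemibalance θ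

/-- The twist `p ⟶ p` that corresponds to `κ`:
`p ⟶ p ⊗ 𝟙_ C ⟶ p ⊗ (perp p ⅋ p) ⟶ (p ⊗ perp p) ⅋ p ⟶ (p ⊗ prep p) ⅋ p ⟶ (prep p ⊗ p) ⅋ p
⟶ d ⅋ p ⟶ p`, where the exchange of `p` and `prep p` is the inverse braiding. -/
def DualIso.twist (κ : DualIso C) (p : C) : p ⟶ p :=
  (ρ_ p).inv ≫ p ◁ (perpDual p).unit ≫ distL p (perp p) p ≫
    (p ◁ (κ.app p).hom) ▷⅋ p ≫ (β_ (prep p) p).inv ▷⅋ p ≫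
    (prepDual p).counit ▷⅋ p ≫ (parLeftUnitor p).hom

end Braided

end StarAut

/-! ### Monoidal laws for par. -/

section ParLemmas

variable {C : Type u} [Category.{v} C] [ParMonoidal C]

/-! A counit `γ : x ⊗ y ⟶ d` is nondegenerate: arrows into `x` or into `y` are determined by their
pairings through `γ` (`whiskerRight_ext`, `whiskerLeft_ext`), and currying realizes every pairing.
So `κ_p` amounts to a pairing on `perp p ⊗ p`, and `θ_p` to a pairing on `p ⊗ perp p`. The bijection
matches them along the braiding: `(κ_p ▷ p) ≫ γ = β ≫ (θ_p ▷ perp p) ≫ γ` (`braiding_twist_counit`,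
`braiding_idApp_counit`). Naturality and invertibility pass across this equation.

For semicycles, the de Morgan arrows carry the composite counits `tensorCup` and `parCup` to the
chosen ones. After pairing, one side of the semicycle equation contains `θ` at the compound object.
The other contains two separate braidings, one per factor; these differ from the braiding of the
compound objects by a double braiding (`parCup_braiding`, `tensorCup_braiding`), which is the one in
the semibalance equation. Cancelling isomorphisms and using nondegeneracy gives the equivalence. -/

lemma par_comp_whiskerRight {a b c : C} (f : a ⟶ b) (g : b ⟶ c) (z : C) :
    (f ≫ g) ▷⅋ z = f ▷⅋ z ≫ g ▷⅋ z :=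
  @MonoidalCategory.comp_whiskerRight C _ ParMonoidal.mon _ _ _ f g z

lemma par_whiskerLeft_comp (z : C) {a b c : C} (f : a ⟶ b) (g : b ⟶ c) :
    z ◁⅋ (f ≫ g) = z ◁⅋ f ≫ z ◁⅋ g :=
  @MonoidalCategory.whiskerLeft_comp C _ ParMonoidal.mon z _ _ _ f g

lemma par_id_whiskerRight (a z : C) : 𝟙 a ▷⅋ z = 𝟙 (a ⅋ z) :=
  @MonoidalCategory.id_whiskerRight C _ ParMonoidal.mon a z

lemma par_whiskerLeft_id (z a : C) : z ◁⅋ 𝟙 a = 𝟙 (z ⅋ a) :=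
  @MonoidalCategory.whiskerLeft_id C _ ParMonoidal.mon z a

lemma par_whisker_exchange {a b c k : C} (f : a ⟶ b) (g : c ⟶ k) :
    a ◁⅋ g ≫ f ▷⅋ k = f ▷⅋ c ≫ b ◁⅋ g :=
  @MonoidalCategory.whisker_exchange C _ ParMonoidal.mon _ _ _ _ f g

lemma parHom_def {a b c k : C} (f : a ⟶ b) (g : c ⟶ k) :
    f ⅋ₘ g = f ▷⅋ c ≫ b ◁⅋ g :=
  @MonoidalCategory.tensorHom_def C _ ParMonoidal.mon _ _ _ _ f g

lemma par_id_tensorHom (a : C) {b c : C} (f : b ⟶ c) : 𝟙 a ⅋ₘ f = a ◁⅋ f :=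
  @MonoidalCategory.id_tensorHom C _ ParMonoidal.mon a _ _ f

lemma par_tensorHom_id {b c : C} (f : b ⟶ c) (a : C) : f ⅋ₘ 𝟙 a = f ▷⅋ a :=
  @MonoidalCategory.tensorHom_id C _ ParMonoidal.mon _ _ f a

lemma parLeftUnitor_naturality {a b : C} (f : a ⟶ b) :
    parUnit C ◁⅋ f ≫ (parLeftUnitor b).hom = (parLeftUnitor a).hom ≫ f :=
  @MonoidalCategory.leftUnitor_naturality C _ ParMonoidal.mon _ _ f

lemma parRightUnitor_naturality {a b : C} (f : a ⟶ b) :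
    f ▷⅋ parUnit C ≫ (parRightUnitor b).hom = (parRightUnitor a).hom ≫ f :=
  @MonoidalCategory.rightUnitor_naturality C _ ParMonoidal.mon _ _ f

lemma parAssoc_naturality_left {a a' : C} (f : a ⟶ a') (b c : C) :
    (f ▷⅋ b) ▷⅋ c ≫ (parAssoc a' b c).hom = (parAssoc a b c).hom ≫ f ▷⅋ (b ⅋ c) :=
  @MonoidalCategory.associator_naturality_left C _ ParMonoidal.mon _ _ f b c

lemma parAssoc_naturality_middle (a : C) {b b' : C} (f : b ⟶ b') (c : C) :
    (a ◁⅋ f) ▷⅋ c ≫ (parAssoc a b' c).hom = (parAssoc a b c).hom ≫ a ◁⅋ f ▷⅋ c :=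
  @MonoidalCategory.associator_naturality_middle C _ ParMonoidal.mon a _ _ f c

lemma parAssoc_naturality_right (a b : C) {c c' : C} (f : c ⟶ c') :
    (a ⅋ b) ◁⅋ f ≫ (parAssoc a b c').hom = (parAssoc a b c).hom ≫ a ◁⅋ b ◁⅋ f :=
  @MonoidalCategory.associator_naturality_right C _ ParMonoidal.mon a b _ _ f

lemma par_triangle (a b : C) :
    (parAssoc a (parUnit C) b).hom ≫ a ◁⅋ (parLeftUnitor b).hom = (parRightUnitor a).hom ▷⅋ b :=
  @MonoidalCategory.triangle C _ ParMonoidal.mon a b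

lemma parLeftUnitor_par (a b : C) :
    (parAssoc (parUnit C) a b).hom ≫ (parLeftUnitor (a ⅋ b)).hom = (parLeftUnitor a).hom ▷⅋ b :=
  (@MonoidalCategory.leftUnitor_tensor_hom'' C _ ParMonoidal.mon a b).trans
    (par_tensorHom_id _ _)

lemma parRightUnitor_par (a b : C) :
    (parAssoc a b (parUnit C)).hom ≫ a ◁⅋ (parRightUnitor b).hom = (parRightUnitor (a ⅋ b)).hom :=
  (@MonoidalCategory.rightUnitor_tensor_hom C _ ParMonoidal.mon a b).symm

lemma par_unit_whiskerRight_injective {a b : C} {f g : a ⟶ b}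
    (h : f ▷⅋ parUnit C = g ▷⅋ parUnit C) : f = g := by
  rw [← cancel_epi (parRightUnitor a).hom, ← parRightUnitor_naturality, h,
    parRightUnitor_naturality]

lemma par_unit_whiskerLeft_injective {a b : C} {f g : a ⟶ b}
    (h : parUnit C ◁⅋ f = parUnit C ◁⅋ g) : f = g := by
  rw [← cancel_epi (parLeftUnitor a).hom, ← parLeftUnitor_naturality, h,
    parLeftUnitor_naturality]

end ParLemmas

/-! ### Naturality of the distributions, one variable at a time. -/

namespace LinearlyDistributive

variable {C : Type u} [Category.{v} C] [MonoidalCategory C] [ParMonoidal C]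
  [LinearlyDistributive C]

lemma distL_naturality_left {a a' : C} (f : a ⟶ a') (b c : C) :
    f ▷ (b ⅋ c) ≫ distL a' b c = distL a b c ≫ (f ▷ b) ▷⅋ c := by
  simpa [par_id_tensorHom, par_tensorHom_id, par_whiskerLeft_id, par_id_whiskerRight] using
    distL_naturality f (𝟙 b) (𝟙 c)

lemma distL_naturality_middle (a : C) {b b' : C} (f : b ⟶ b') (c : C) :
    a ◁ (f ▷⅋ c) ≫ distL a b' c = distL a b c ≫ (a ◁ f) ▷⅋ c := by
  simpa [par_id_tensorHom, par_tensorHom_id, par_whiskerLeft_id, par_id_whiskerRight] using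
    distL_naturality (𝟙 a) f (𝟙 c)

lemma distL_naturality_right (a b : C) {c c' : C} (f : c ⟶ c') :
    a ◁ (b ◁⅋ f) ≫ distL a b c' = distL a b c ≫ (a ⊗ b) ◁⅋ f := by
  simpa [par_id_tensorHom, par_tensorHom_id, par_whiskerLeft_id, par_id_whiskerRight] using
    distL_naturality (𝟙 a) (𝟙 b) f

lemma distR_naturality_left {a a' : C} (f : a ⟶ a') (b c : C) :
    (f ▷⅋ b) ▷ c ≫ distR a' b c = distR a b c ≫ f ▷⅋ (b ⊗ c) := by
  simpa [par_id_tensorHom, par_tensorHom_id, par_whiskerLeft_id, par_id_whiskerRight] using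
    distR_naturality f (𝟙 b) (𝟙 c)

lemma distR_naturality_middle (a : C) {b b' : C} (f : b ⟶ b') (c : C) :
    (a ◁⅋ f) ▷ c ≫ distR a b' c = distR a b c ≫ a ◁⅋ (f ▷ c) := by
  simpa [par_id_tensorHom, par_tensorHom_id, par_whiskerLeft_id, par_id_whiskerRight] using
    distR_naturality (𝟙 a) f (𝟙 c)

lemma distR_naturality_right (a b : C) {c c' : C} (f : c ⟶ c') :
    (a ⅋ b) ◁ f ≫ distR a b c' = distR a b c ≫ a ◁⅋ (b ◁ f) := by
  simpa [par_id_tensorHom, par_tensorHom_id, par_whiskerLeft_id, par_id_whiskerRight] using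
    distR_naturality (𝟙 a) (𝟙 b) f

end LinearlyDistributive

/-! ### Transposition along a linear duality, and induced dualities. -/

section Transpose

open LinearlyDistributive

variable {C : Type u} [Category.{v} C] [MonoidalCategory C] [ParMonoidal C]
  [LinearlyDistributive C]

/-- The transpose `t ⟶ y ⅋ z` of `f : x ⊗ t ⟶ z`, formed with `τ : 𝟙_ C ⟶ y ⅋ x`. -/
def lTranspose {x y t z : C} (τ : 𝟙_ C ⟶ y ⅋ x) (f : x ⊗ t ⟶ z) : t ⟶ y ⅋ z :=
  (λ_ t).inv ≫ τ ▷ t ≫ distR y x t ≫ y ◁⅋ f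

/-- The transpose `x ⊗ t ⟶ z` of `g : t ⟶ y ⅋ z`, formed with `γ : x ⊗ y ⟶ d`. -/
def lUntranspose {x y t z : C} (γ : x ⊗ y ⟶ parUnit C) (g : t ⟶ y ⅋ z) : x ⊗ t ⟶ z :=
  x ◁ g ≫ distL x y z ≫ γ ▷⅋ z ≫ (parLeftUnitor z).hom

/-- The transpose `t ⟶ z ⅋ x` of `f : t ⊗ y ⟶ z`, formed with `τ : 𝟙_ C ⟶ y ⅋ x`. -/
def rTranspose {x y t z : C} (τ : 𝟙_ C ⟶ y ⅋ x) (f : t ⊗ y ⟶ z) : t ⟶ z ⅋ x :=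
  (ρ_ t).inv ≫ t ◁ τ ≫ distL t y x ≫ f ▷⅋ x

/-- The transpose `t ⊗ y ⟶ z` of `g : t ⟶ z ⅋ x`, formed with `γ : x ⊗ y ⟶ d`. -/
def rUntranspose {x y t z : C} (γ : x ⊗ y ⟶ parUnit C) (g : t ⟶ z ⅋ x) : t ⊗ y ⟶ z :=
  g ▷ y ≫ distR z x y ≫ z ◁⅋ γ ≫ (parRightUnitor z).hom

/-- `dist_tensor` lets `γ` meet `τ` before `t` is involved. No triangle identity is assumed: the
failure of the round trip to be the identity is exactly the triangle composite, so round trips can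
be used to prove triangle identities. -/
lemma lUntranspose_lTranspose {x y t z : C} (τ : 𝟙_ C ⟶ y ⅋ x) (γ : x ⊗ y ⟶ parUnit C)
    (f : x ⊗ t ⟶ z) : lUntranspose γ (lTranspose τ f) = rCurry τ γ ▷ t ≫ f := by
  simp only [lUntranspose, lTranspose, rCurry, comp_whiskerRight, MonoidalCategory.whiskerLeft_comp,
    Category.assoc, reassoc_of% distL_naturality_right, reassoc_of% par_whisker_exchange,
    parLeftUnitor_naturality]
  have h := dist_tensor x y x t
  rw [← Iso.inv_comp_eq] at h
  rw [← reassoc_of% h, ← reassoc_of% distR_naturality_left, reassoc_of% distR_leftUnitor]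
  simp

/-- The same argument for the other round trip, with `dist_par` as the interchange. -/
lemma lTranspose_lUntranspose {x y t z : C} (τ : 𝟙_ C ⟶ y ⅋ x) (γ : x ⊗ y ⟶ parUnit C)
    (g : t ⟶ y ⅋ z) : lTranspose τ (lUntranspose γ g) = g ≫ lCurry τ γ ▷⅋ z := by
  simp only [lUntranspose, lTranspose, lCurry, par_comp_whiskerRight, par_whiskerLeft_comp]
  rw [← reassoc_of% distR_naturality_right, ← reassoc_of% dist_par,
    ← reassoc_of% parAssoc_naturality_middle,
    par_triangle, ← whisker_exchange_assoc, ← leftUnitor_inv_naturality_assoc,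
    reassoc_of% distL_naturality_left]
  have h : (λ_ (y ⅋ z)).inv ≫ distL (𝟙_ C) y z = (λ_ y).inv ▷⅋ z := by
    rw [Iso.inv_comp_eq, ← distL_leftUnitor, Category.assoc, ← par_comp_whiskerRight]
    simp [par_id_whiskerRight]
  rw [reassoc_of% h]

lemma rUntranspose_rTranspose {x y t z : C} (τ : 𝟙_ C ⟶ y ⅋ x) (γ : x ⊗ y ⟶ parUnit C)
    (f : t ⊗ y ⟶ z) : rUntranspose γ (rTranspose τ f) = t ◁ lCurry τ γ ≫ f := by
  simp only [rUntranspose, rTranspose, lCurry, comp_whiskerRight,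
    MonoidalCategory.whiskerLeft_comp, Category.assoc, reassoc_of% distR_naturality_left,
    ← reassoc_of% par_whisker_exchange, parRightUnitor_naturality]
  rw [reassoc_of% dist_tensor, ← reassoc_of% distL_naturality_right, reassoc_of% distL_rightUnitor]
  simp

lemma rTranspose_rUntranspose {x y t z : C} (τ : 𝟙_ C ⟶ y ⅋ x) (γ : x ⊗ y ⟶ parUnit C)
    (g : t ⟶ z ⅋ x) : rTranspose τ (rUntranspose γ g) = g ≫ z ◁⅋ rCurry τ γ := by
  simp only [rUntranspose, rTranspose, rCurry, par_comp_whiskerRight, par_whiskerLeft_comp]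
  rw [← reassoc_of% distL_naturality_left, whisker_exchange_assoc,
    ← rightUnitor_inv_naturality_assoc,
    ← par_triangle, reassoc_of% parAssoc_naturality_middle, reassoc_of% dist_par,
    reassoc_of% distR_naturality_right]
  have h : (ρ_ (z ⅋ x)).inv ≫ distR z x (𝟙_ C) = z ◁⅋ (ρ_ x).inv := by
    rw [Iso.inv_comp_eq, ← distR_rightUnitor, Category.assoc, ← par_whiskerLeft_comp]
    simp [par_whiskerLeft_id]
  rw [reassoc_of% h]

lemma lTranspose_comp_rightUnitor {x y t : C} (τ : 𝟙_ C ⟶ y ⅋ x) (f : x ⊗ t ⟶ parUnit C) :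
    lTranspose τ f ≫ (parRightUnitor y).hom = lCurry τ f := by
  simp [lTranspose, lCurry]

lemma rTranspose_comp_leftUnitor {x y t : C} (τ : 𝟙_ C ⟶ y ⅋ x) (f : t ⊗ y ⟶ parUnit C) :
    rTranspose τ f ≫ (parLeftUnitor x).hom = rCurry τ f := by
  simp [rTranspose, rCurry]

lemma lUntranspose_rightUnitor {x y t : C} (γ : x ⊗ y ⟶ parUnit C) (g : t ⟶ y ⅋ parUnit C) :
    lUntranspose γ g = x ◁ (g ≫ (parRightUnitor y).hom) ≫ γ := by
  have h : (parLeftUnitor (parUnit C)).hom = (parRightUnitor (parUnit C)).hom :=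
    @MonoidalCategory.unitors_equal C _ ParMonoidal.mon
  simp only [lUntranspose]
  rw [h, parRightUnitor_naturality, reassoc_of% distL_rightUnitor,
    MonoidalCategory.whiskerLeft_comp, Category.assoc]

lemma rUntranspose_leftUnitor {x y t : C} (γ : x ⊗ y ⟶ parUnit C) (g : t ⟶ parUnit C ⅋ x) :
    rUntranspose γ g = (g ≫ (parLeftUnitor x).hom) ▷ y ≫ γ := by
  have h : (parLeftUnitor (parUnit C)).hom = (parRightUnitor (parUnit C)).hom :=
    @MonoidalCategory.unitors_equal C _ ParMonoidal.mon
  simp only [rUntranspose]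
  rw [← h, parLeftUnitor_naturality, reassoc_of% distR_leftUnitor, comp_whiskerRight,
    Category.assoc]

namespace LinearDual

variable {x y : C} (D : LinearDual x y)

@[simp]
lemma whiskerLeft_lCurry {t : C} (ω : x ⊗ t ⟶ parUnit C) :
    x ◁ lCurry D.unit ω ≫ D.counit = ω := by
  rw [← lTranspose_comp_rightUnitor, ← lUntranspose_rightUnitor, lUntranspose_lTranspose,
    D.triangle_left, id_whiskerRight, Category.id_comp]

@[simp]
lemma rCurry_whiskerRight {t : C} (ψ : t ⊗ y ⟶ parUnit C) :
    rCurry D.unit ψ ▷ y ≫ D.counit = ψ := by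
  rw [← rTranspose_comp_leftUnitor, ← rUntranspose_leftUnitor, rUntranspose_rTranspose,
    D.triangle_right, whiskerLeft_id, Category.id_comp]

lemma lCurry_whiskerLeft {t : C} (f : t ⟶ y) : lCurry D.unit (x ◁ f ≫ D.counit) = f := by
  have h := D.triangle_right
  simp only [lCurry, par_whiskerLeft_comp, Category.assoc] at h ⊢
  rw [← reassoc_of% distR_naturality_right, ← whisker_exchange_assoc,
    ← leftUnitor_inv_naturality_assoc,
    h, Category.comp_id]

lemma rCurry_whiskerRight_counit {t : C} (f : t ⟶ x) : rCurry D.unit (f ▷ y ≫ D.counit) = f := by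
  have h := D.triangle_left
  simp only [rCurry, par_comp_whiskerRight, Category.assoc] at h ⊢
  rw [← reassoc_of% distL_naturality_left, whisker_exchange_assoc,
    ← rightUnitor_inv_naturality_assoc,
    h, Category.comp_id]

/-- Nondegeneracy of the counit: currying recovers an arrow from its pairing. -/
lemma whiskerLeft_ext {t : C} {f g : t ⟶ y} (h : x ◁ f ≫ D.counit = x ◁ g ≫ D.counit) :
    f = g := by
  rw [← D.lCurry_whiskerLeft f, h, D.lCurry_whiskerLeft]

lemma whiskerRight_ext {t : C} {f g : t ⟶ x} (h : f ▷ y ≫ D.counit = g ▷ y ≫ D.counit) :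
    f = g := by
  rw [← D.rCurry_whiskerRight_counit f, h, D.rCurry_whiskerRight_counit]

end LinearDual

/-- The counit of the duality between `x ⊗ x'` and `y' ⅋ y` that is induced by counits of
dualities between `x`, `y` and between `x'`, `y'`. -/
def tensorCup {x y x' y' : C} (γ : x ⊗ y ⟶ parUnit C) (γ' : x' ⊗ y' ⟶ parUnit C) :
    (x ⊗ x') ⊗ (y' ⅋ y) ⟶ parUnit C :=
  (α_ x x' (y' ⅋ y)).hom ≫
    x ◁ (distL x' y' y ≫ γ' ▷⅋ y ≫ (parLeftUnitor y).hom) ≫ γ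

/-- Transposing along the composite unit is transposing twice, up to associators. With the matching
statement for untransposition, the round trip for the composite duality becomes two nested round
trips. -/
lemma lTranspose_tensorCap {x y x' y' t z : C} (τ : 𝟙_ C ⟶ y ⅋ x) (τ' : 𝟙_ C ⟶ y' ⅋ x')
    (f : (x ⊗ x') ⊗ t ⟶ z) :
    lTranspose (tensorCap τ τ') f =
      lTranspose τ' (lTranspose τ ((α_ x x' t).inv ≫ f)) ≫ (parAssoc y' y z).inv := by
  rw [Iso.eq_comp_inv]
  simp only [lTranspose, tensorCap, comp_whiskerRight, par_whiskerLeft_comp, Category.assoc,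
    parAssoc_naturality_right, reassoc_of% distR_par]
  rw [← comp_whiskerRight_assoc (parAssoc _ _ _).inv]
  simp only [Iso.inv_hom_id, id_whiskerRight, Category.id_comp, reassoc_of% distR_naturality_middle]
  have h : (λ_ x').inv ▷ t ≫ τ ▷ x' ▷ t ≫ distR y x x' ▷ t ≫ distR y (x ⊗ x') t =
      (λ_ (x' ⊗ t)).inv ≫ τ ▷ (x' ⊗ t) ≫ distR y x (x' ⊗ t) ≫ y ◁⅋ (α_ x x' t).inv := by
    have e : y ◁⅋ (α_ x x' t).hom ≫ y ◁⅋ (α_ x x' t).inv = 𝟙 _ := by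
      rw [← par_whiskerLeft_comp, Iso.hom_inv_id, par_whiskerLeft_id]
    have h' := (reassoc_of% (distR_tensor y x x' t)) (y ◁⅋ (α_ x x' t).inv)
    rw [e, Category.comp_id] at h'
    rw [← h']
    simp
  simp only [← par_whiskerLeft_comp]
  rw [reassoc_of% h, par_whiskerLeft_comp y]

lemma lUntranspose_tensorCup {x y x' y' t z : C} (γ : x ⊗ y ⟶ parUnit C)
    (γ' : x' ⊗ y' ⟶ parUnit C) (g : t ⟶ (y' ⅋ y) ⅋ z) :
    lUntranspose (tensorCup γ γ') g = (α_ x x' t).hom ≫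
      lUntranspose γ (lUntranspose γ' (g ≫ (parAssoc y' y z).hom)) := by
  simp only [lUntranspose, tensorCup, par_comp_whiskerRight, MonoidalCategory.whiskerLeft_comp,
    Category.assoc, reassoc_of% distL_tensor]
  have e : x ◁ x' ◁ (parAssoc y' y z).hom ≫ x ◁ distL x' y' (y ⅋ z) ≫
      x ◁ γ' ▷⅋ (y ⅋ z) ≫ x ◁ (parLeftUnitor (y ⅋ z)).hom =
      x ◁ distL x' (y' ⅋ y) z ≫ x ◁ (distL x' y' y ≫ γ' ▷⅋ y ≫ (parLeftUnitor y).hom) ▷⅋ z := by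
    simp only [← MonoidalCategory.whiskerLeft_comp]
    congr 1
    simp only [reassoc_of% distL_par, ← reassoc_of% parAssoc_naturality_left, parLeftUnitor_par,
      par_comp_whiskerRight]
  rw [reassoc_of% e, reassoc_of% distL_naturality_middle]
  simp [par_comp_whiskerRight]

lemma rTranspose_parCap {x y x' y' t z : C} (τ : 𝟙_ C ⟶ y ⅋ x) (τ' : 𝟙_ C ⟶ y' ⅋ x')
    (f : t ⊗ (y' ⊗ y) ⟶ z) :
    rTranspose (parCap τ τ') f =
      rTranspose τ' (rTranspose τ ((α_ t y' y).hom ≫ f)) ≫ (parAssoc z x x').hom := by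
  simp only [rTranspose, parCap, MonoidalCategory.whiskerLeft_comp, par_comp_whiskerRight,
    Category.assoc, parAssoc_naturality_left, reassoc_of% distL_par,
    reassoc_of% distL_naturality_middle]
  have h : t ◁ (ρ_ y').inv ≫ t ◁ y' ◁ τ ≫ t ◁ distL y' y x ≫ distL t (y' ⊗ y) x =
      (ρ_ (t ⊗ y')).inv ≫ (t ⊗ y') ◁ τ ≫ distL (t ⊗ y') y x ≫ (α_ t y' y).hom ▷⅋ x := by
    rw [distL_tensor]
    simp
  simp only [← reassoc_of% par_comp_whiskerRight, h]

lemma rUntranspose_parCup {x y x' y' t z : C} (γ : x ⊗ y ⟶ parUnit C)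
    (γ' : x' ⊗ y' ⟶ parUnit C) (g : t ⟶ z ⅋ (x ⅋ x')) :
    rUntranspose (parCup γ γ') g = (α_ t y' y).inv ≫
      rUntranspose γ (rUntranspose γ' (g ≫ (parAssoc z x x').inv)) := by
  have e : distR z (x ⅋ x') y' ≫
      z ◁⅋ (distR x x' y' ≫ x ◁⅋ γ' ≫ (parRightUnitor x).hom) =
      (parAssoc z x x').inv ▷ y' ≫ distR (z ⅋ x) x' y' ≫ (z ⅋ x) ◁⅋ γ' ≫
        (parRightUnitor (z ⅋ x)).hom := by
    rw [← parRightUnitor_par, reassoc_of% parAssoc_naturality_right, reassoc_of% distR_par,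
      ← comp_whiskerRight_assoc, Iso.inv_hom_id, id_whiskerRight, Category.id_comp]
    simp only [par_whiskerLeft_comp]
  have h := distR_tensor z (x ⅋ x') y' y
  rw [← Iso.eq_inv_comp] at h
  have e' : z ◁⅋ (α_ (x ⅋ x') y' y).hom ≫ z ◁⅋ (α_ (x ⅋ x') y' y).inv = 𝟙 _ := by
    rw [← par_whiskerLeft_comp, Iso.hom_inv_id, par_whiskerLeft_id]
  simp only [rUntranspose, parCup, par_whiskerLeft_comp, Category.assoc, h]
  rw [reassoc_of% e', ← reassoc_of% distR_naturality_middle,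
    ← comp_whiskerRight_assoc (distR _ _ _), e]
  simp

/-- Dualities between `x`, `y` and between `x'`, `y'` induce one between `x ⊗ x'` and
`y' ⅋ y`. -/
def LinearDual.tensor {x y x' y' : C} (D : LinearDual x y) (D' : LinearDual x' y') :
    LinearDual (x ⊗ x') (y' ⅋ y) where
  unit := tensorCap D.unit D'.unit
  counit := tensorCup D.counit D'.counit
  triangle_left := by
    -- Taking `t` to be the tensor unit and `f` the right unitor exhibits the triangle composite
    -- itself as a round trip.
    have h := lUntranspose_lTranspose (tensorCap D.unit D'.unit) (tensorCup D.counit D'.counit)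
      (ρ_ (x ⊗ x')).hom
    rw [rightUnitor_naturality, ← Iso.inv_comp_eq] at h
    rw [← h, lUntranspose_tensorCup, lTranspose_tensorCap]
    simp [lUntranspose_lTranspose, D.triangle_left, D'.triangle_left]
  triangle_right := by
    apply par_unit_whiskerRight_injective
    -- The round trip of the identity, with `z = d`, is the triangle composite whiskered by `d`;
    -- such whiskering is faithful.
    have h := lTranspose_lUntranspose (tensorCap D.unit D'.unit) (tensorCup D.counit D'.counit)
      (𝟙 ((y' ⅋ y) ⅋ parUnit C))
    rw [Category.id_comp] at h
    rw [← h, lTranspose_tensorCap, lUntranspose_tensorCup]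
    simp [lTranspose_lUntranspose, D.triangle_right, D'.triangle_right, par_id_whiskerRight]

/-- Dualities between `x`, `y` and between `x'`, `y'` induce one between `x ⅋ x'` and
`y' ⊗ y`. -/
def LinearDual.par {x y x' y' : C} (D : LinearDual x y) (D' : LinearDual x' y') :
    LinearDual (x ⅋ x') (y' ⊗ y) where
  unit := parCap D.unit D'.unit
  counit := parCup D.counit D'.counit
  triangle_left := by
    apply par_unit_whiskerLeft_injective
    have h := rTranspose_rUntranspose (parCap D.unit D'.unit) (parCup D.counit D'.counit)
      (𝟙 (parUnit C ⅋ (x ⅋ x')))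
    rw [Category.id_comp] at h
    rw [← h, rTranspose_parCap, rUntranspose_parCup]
    simp [rTranspose_rUntranspose, D.triangle_left, D'.triangle_left, par_whiskerLeft_id]
  triangle_right := by
    have h := rUntranspose_rTranspose (parCap D.unit D'.unit) (parCup D.counit D'.counit)
      (λ_ (y' ⊗ y)).hom
    rw [leftUnitor_naturality, ← Iso.inv_comp_eq] at h
    rw [← h, rUntranspose_parCup, rTranspose_parCap]
    simp [rUntranspose_rTranspose, D.triangle_right, D'.triangle_right]

end Transpose

/-! ### Interchange of pairings, and naturality of the composite counits. -/

section Exchange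

open LinearlyDistributive

variable {C : Type u} [Category.{v} C] [MonoidalCategory C] [ParMonoidal C]
  [LinearlyDistributive C]

lemma tensorCup_eq {x y x' y' : C} (γ : x ⊗ y ⟶ parUnit C) (γ' : x' ⊗ y' ⟶ parUnit C) :
    tensorCup γ γ' = (α_ x x' (y' ⅋ y)).hom ≫ x ◁ lUntranspose γ' (𝟙 (y' ⅋ y)) ≫ γ := by
  simp [tensorCup, lUntranspose]

lemma parCup_eq {x y x' y' : C} (γ : x ⊗ y ⟶ parUnit C) (γ' : x' ⊗ y' ⟶ parUnit C) :
    parCup γ γ' = (α_ (x ⅋ x') y' y).inv ≫ rUntranspose γ' (𝟙 (x ⅋ x')) ▷ y ≫ γ := by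
  simp [parCup, rUntranspose]

/-- Pairing a par on the left and on the right can be done in either order. -/
lemma untranspose_exchange {x y a b : C} (φ : x ⊗ a ⟶ parUnit C) (ψ : b ⊗ y ⟶ parUnit C) :
    x ◁ rUntranspose ψ (𝟙 (a ⅋ b)) ≫ φ =
      (α_ x (a ⅋ b) y).inv ≫ lUntranspose φ (𝟙 (a ⅋ b)) ▷ y ≫ ψ := by
  -- Each side is an untranspose into `d`; `dist_tensor` then makes the two agree up to the order of
  -- the independent maps `φ` and `ψ`.
  have h := lUntranspose_rightUnitor φ (distR a b y ≫ a ◁⅋ ψ)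
  have h' := rUntranspose_leftUnitor ψ (distL x a b ≫ φ ▷⅋ b)
  simp only [rUntranspose, lUntranspose, id_whiskerRight, whiskerLeft_id,
    Category.id_comp, Category.assoc, MonoidalCategory.whiskerLeft_comp,
    comp_whiskerRight] at h h' ⊢
  rw [← h, ← h', reassoc_of% distL_naturality_right, reassoc_of% distR_naturality_left,
    reassoc_of% dist_tensor,
    Iso.inv_hom_id_assoc, reassoc_of% par_whisker_exchange]
  have e : (parLeftUnitor (parUnit C)).hom = (parRightUnitor (parUnit C)).hom :=
    @MonoidalCategory.unitors_equal C _ ParMonoidal.mon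
  rw [e]

/-- Arrows on the factors are absorbed into the individual pairings, so that an equation known for
each factor can be applied inside `parCup`. -/
lemma parCup_naturality {x y x' y' a a' : C} (f : a ⟶ x) (f' : a' ⟶ x')
    (γ : x ⊗ y ⟶ parUnit C) (γ' : x' ⊗ y' ⟶ parUnit C) :
    (f ⅋ₘ f') ▷ (y' ⊗ y) ≫ parCup γ γ' = parCup (f ▷ y ≫ γ) (f' ▷ y' ≫ γ') := by
  have e : (f ⅋ₘ f') ▷ y' ≫ distR x x' y' ≫ x ◁⅋ γ' ≫ (parRightUnitor x).hom =
      (distR a a' y' ≫ a ◁⅋ (f' ▷ y' ≫ γ') ≫ (parRightUnitor a).hom) ≫ f := by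
    rw [parHom_def, comp_whiskerRight, Category.assoc, reassoc_of% distR_naturality_middle,
      reassoc_of% distR_naturality_left, ← reassoc_of% par_whiskerLeft_comp,
      ← reassoc_of% par_whisker_exchange,
      parRightUnitor_naturality]
    simp
  rw [parCup, associator_inv_naturality_left_assoc, ← comp_whiskerRight_assoc, e, parCup]
  simp

lemma parCup_whiskerLeft {x y x' y' b b' : C} (g : b ⟶ y) (g' : b' ⟶ y')
    (γ : x ⊗ y ⟶ parUnit C) (γ' : x' ⊗ y' ⟶ parUnit C) :
    (x ⅋ x') ◁ (g' ⊗ₘ g) ≫ parCup γ γ' = parCup (x ◁ g ≫ γ) (x' ◁ g' ≫ γ') := by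
  have e : (x ⅋ x') ◁ g' ≫ distR x x' y' ≫ x ◁⅋ γ' ≫ (parRightUnitor x).hom =
      (distR x x' b' ≫ x ◁⅋ (x' ◁ g' ≫ γ') ≫ (parRightUnitor x).hom) := by
    rw [reassoc_of% distR_naturality_right]
    simp [par_whiskerLeft_comp]
  rw [parCup, MonoidalCategory.tensorHom_def', MonoidalCategory.whiskerLeft_comp, Category.assoc,
    associator_inv_naturality_middle_assoc, associator_inv_naturality_right_assoc,
    ← comp_whiskerRight_assoc, e, parCup, whisker_exchange_assoc]

lemma tensorCup_naturality {x y x' y' a a' : C} (f : a ⟶ x) (f' : a' ⟶ x')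
    (γ : x ⊗ y ⟶ parUnit C) (γ' : x' ⊗ y' ⟶ parUnit C) :
    (f ⊗ₘ f') ▷ (y' ⅋ y) ≫ tensorCup γ γ' = tensorCup (f ▷ y ≫ γ) (f' ▷ y' ≫ γ') := by
  have e : f' ▷ (y' ⅋ y) ≫ distL x' y' y ≫ γ' ▷⅋ y ≫ (parLeftUnitor y).hom =
      distL a' y' y ≫ (f' ▷ y' ≫ γ') ▷⅋ y ≫ (parLeftUnitor y).hom := by
    rw [reassoc_of% distL_naturality_left]
    simp [par_comp_whiskerRight]
  rw [tensorCup, MonoidalCategory.tensorHom_def, comp_whiskerRight, Category.assoc,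
    associator_naturality_middle_assoc, associator_naturality_left_assoc,
    ← MonoidalCategory.whiskerLeft_comp_assoc, e, tensorCup, whisker_exchange_assoc]

end Exchange

/-! ### How the composite counits interact with the braiding. -/

section BraidedExchange

variable {C : Type u} [Category.{v} C] [MonoidalCategory C] [BraidedCategory C]

/-- Bringing `q` and then `p` to the front crosses `s` once with each and makes `p` and `q` cross
each other twice. This is the source of the double braiding in the tensor-semibalance equation. -/
lemma braiding_rotate_left (s p q : C) :
    (α_ s p q).inv ≫ (β_ (s ⊗ p) q).hom ≫ (α_ q s p).inv ≫ (β_ (q ⊗ s) p).hom =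
      (β_ s (p ⊗ q)).hom ≫ ((β_ p q).hom ≫ (β_ q p).hom) ▷ s ≫ (α_ p q s).hom := by
  -- Sliding one crossing of `p` and `q` through `s` makes both sides expand, by the hexagons, to
  -- the same braid.
  rw [comp_whiskerRight_assoc, ← BraidedCategory.braiding_naturality_right_assoc]
  simp [BraidedCategory.braiding_tensor_left_hom, BraidedCategory.braiding_tensor_right_hom]

lemma braiding_rotate_right (a b s : C) :
    (α_ a b s).hom ≫ (β_ a (b ⊗ s)).hom ≫ (α_ b s a).hom ≫ (β_ b (s ⊗ a)).hom =
      (β_ (a ⊗ b) s).hom ≫ s ◁ ((β_ a b).hom ≫ (β_ b a).hom) ≫ (α_ s a b).inv := by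
  rw [MonoidalCategory.whiskerLeft_comp_assoc, ← BraidedCategory.braiding_naturality_left_assoc]
  simp [BraidedCategory.braiding_tensor_left_hom, BraidedCategory.braiding_tensor_right_hom]

variable [ParMonoidal C] [LinearlyDistributive C]

/-- Naturality pulls the two separate braidings out of the nested pairings, `untranspose_exchange`
reorders the pairings, and `braiding_rotate_left` compares the resulting braids. -/
lemma parCup_braiding {p q y y' : C} (φ : p ⊗ y ⟶ parUnit C) (φ' : q ⊗ y' ⟶ parUnit C) :
    parCup ((β_ y' q).hom ≫ φ') ((β_ y p).hom ≫ φ) =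
      (β_ (y' ⅋ y) (p ⊗ q)).hom ≫ ((β_ p q).hom ≫ (β_ q p).hom) ▷ (y' ⅋ y) ≫
        tensorCup φ φ' := by
  rw [parCup_eq, tensorCup_eq, BraidedCategory.braiding_naturality_left_assoc,
    untranspose_exchange, BraidedCategory.braiding_naturality_left_assoc]
  have h := braiding_rotate_left (y' ⅋ y) p q
  simp only [← Category.assoc] at h ⊢
  rw [h]

lemma tensorCup_braiding {p q a b : C} (φ : p ⊗ b ⟶ parUnit C) (φ' : q ⊗ a ⟶ parUnit C) :
    tensorCup ((β_ a q).hom ≫ φ') ((β_ b p).hom ≫ φ) =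
      (β_ (a ⊗ b) (p ⅋ q)).hom ≫ (p ⅋ q) ◁ ((β_ a b).hom ≫ (β_ b a).hom) ≫
        parCup φ φ' := by
  have h := untranspose_exchange ((β_ b p).hom ≫ φ) φ'
  rw [Iso.eq_inv_comp] at h
  rw [parCup_eq, tensorCup_eq, BraidedCategory.braiding_naturality_right_assoc,
    ← h, BraidedCategory.braiding_naturality_right_assoc]
  have h' := braiding_rotate_right a b (p ⅋ q)
  simp only [← Category.assoc] at h' ⊢
  rw [h']

end BraidedExchange

section IdApp

variable {C : Type u} [Category.{v} C]

/-- The component at `p` of an automorphism of the identity functor. -/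
def idApp (θ : 𝟭 C ≅ 𝟭 C) (p : C) : p ⟶ p := θ.hom.app p

lemma idApp_naturality (θ : 𝟭 C ≅ 𝟭 C) {p q : C} (f : p ⟶ q) :
    f ≫ idApp θ q = idApp θ p ≫ f :=
  θ.hom.naturality f

@[simp]
lemma idApp_symm (θ : 𝟭 C ≅ 𝟭 C) (p : C) : idApp θ p ≫ idApp θ.symm p = 𝟙 p :=
  θ.hom_inv_id_app p

@[simp]
lemma idApp_symm' (θ : 𝟭 C ≅ 𝟭 C) (p : C) : idApp θ.symm p ≫ idApp θ p = 𝟙 p :=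
  θ.inv_hom_id_app p

end IdApp

/-! ### Duals, de Morgan arrows and the par braiding, seen through counits. -/

section StarAut

open LinearlyDistributive StarAutonomous

variable {C : Type u} [Category.{v} C] [MonoidalCategory C] [ParMonoidal C]
  [LinearlyDistributive C] [StarAutonomous C]

lemma perpMap_counit {p q : C} (f : p ⟶ q) :
    p ◁ perpMap f ≫ (perpDual p).counit = f ▷ perp q ≫ (perpDual q).counit :=
  (perpDual p).whiskerLeft_lCurry _

lemma prepMap_counit {p q : C} (f : p ⟶ q) :
    prepMap f ▷ p ≫ (prepDual p).counit = prep q ◁ f ≫ (prepDual q).counit :=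
  (prepDual p).rCurry_whiskerRight _

/-- This and its three analogues characterize the de Morgan arrows by what they do to counits. -/
lemma perpTensor_counit (p q : C) :
    (p ⊗ q) ◁ perpTensor p q ≫ tensorCup (perpDual p).counit (perpDual q).counit =
      (perpDual (p ⊗ q)).counit :=
  ((perpDual p).tensor (perpDual q)).whiskerLeft_lCurry _

lemma prepTensor_counit (p q : C) :
    prepTensor p q ▷ (p ⊗ q) ≫ parCup (prepDual q).counit (prepDual p).counit =
      (prepDual (p ⊗ q)).counit :=
  ((prepDual q).par (prepDual p)).rCurry_whiskerRight _

lemma perpPar_counit (p q : C) :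
    (p ⅋ q) ◁ perpPar p q ≫ parCup (perpDual p).counit (perpDual q).counit =
      (perpDual (p ⅋ q)).counit :=
  ((perpDual p).par (perpDual q)).whiskerLeft_lCurry _

lemma prepPar_counit (p q : C) :
    prepPar p q ▷ (p ⅋ q) ≫ tensorCup (prepDual q).counit (prepDual p).counit =
      (prepDual (p ⅋ q)).counit :=
  ((prepDual q).tensor (prepDual p)).rCurry_whiskerRight _

/-- Invertibility is what allows this arrow to be cancelled when deducing the semibalance equation
from the semicycle equation. -/
instance perpTensor_isIso (p q : C) : IsIso (perpTensor p q) := by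
  refine ⟨lCurry (perpDual (p ⊗ q)).unit
    (tensorCup (perpDual p).counit (perpDual q).counit), ?_, ?_⟩
  · apply (perpDual (p ⊗ q)).whiskerLeft_ext
    rw [MonoidalCategory.whiskerLeft_comp_assoc, LinearDual.whiskerLeft_lCurry,
      perpTensor_counit, whiskerLeft_id, Category.id_comp]
  · apply ((perpDual p).tensor (perpDual q)).whiskerLeft_ext
    rw [LinearDual.tensor, MonoidalCategory.whiskerLeft_comp_assoc, perpTensor_counit,
      LinearDual.whiskerLeft_lCurry, whiskerLeft_id, Category.id_comp]

instance perpPar_isIso (p q : C) : IsIso (perpPar p q) := by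
  refine ⟨lCurry (perpDual (p ⅋ q)).unit
    (parCup (perpDual p).counit (perpDual q).counit), ?_, ?_⟩
  · apply (perpDual (p ⅋ q)).whiskerLeft_ext
    rw [MonoidalCategory.whiskerLeft_comp_assoc, LinearDual.whiskerLeft_lCurry,
      perpPar_counit, whiskerLeft_id, Category.id_comp]
  · apply ((perpDual p).par (perpDual q)).whiskerLeft_ext
    rw [LinearDual.par, MonoidalCategory.whiskerLeft_comp_assoc, perpPar_counit,
      LinearDual.whiskerLeft_lCurry, whiskerLeft_id, Category.id_comp]

variable [BraidedCategory C]

/-- The par braiding is adjoint, under the pairings, to the tensor braiding of the right duals. -/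
lemma parBraiding_counit (p q : C) :
    parBraiding p q ▷ (perp p ⊗ perp q) ≫ parCup (perpDual q).counit (perpDual p).counit =
      (p ⅋ q) ◁ (β_ (perp p) (perp q)).hom ≫
        parCup (perpDual p).counit (perpDual q).counit := by
  have h := ((perpDual q).par (perpDual p)).rCurry_whiskerRight
    ((p ⅋ q) ◁ (β_ (perp p) (perp q)).hom ≫ parCup (perpDual p).counit (perpDual q).counit)
  simp only [LinearDual.par] at h
  rw [← h]
  congr 2
  -- By naturality of the distribution, a braiding inserted in the unit may be moved into the
  -- curried pairing.
  simp only [parBraiding, rCurry, MonoidalCategory.whiskerLeft_comp, Category.assoc,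
    reassoc_of% distL_naturality_middle, par_comp_whiskerRight]

/-! ### The bijection and its restrictions. -/

namespace DualIso

lemma twist_counit (κ : DualIso C) (p : C) :
    κ.twist p ▷ perp p ≫ (perpDual p).counit =
      p ◁ (κ.app p).hom ≫ (β_ (prep p) p).inv ≫ (prepDual p).counit := by
  have h : κ.twist p = rCurry (perpDual p).unit
      (p ◁ (κ.app p).hom ≫ (β_ (prep p) p).inv ≫ (prepDual p).counit) := by
    simp only [twist, rCurry, par_comp_whiskerRight, Category.assoc]
  rw [h, LinearDual.rCurry_whiskerRight]

/-- The equation that determines `κ` and its twist from each other. -/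
lemma braiding_twist_counit (κ : DualIso C) (p : C) :
    (β_ (perp p) p).hom ≫ κ.twist p ▷ perp p ≫ (perpDual p).counit =
      (κ.app p).hom ▷ p ≫ (prepDual p).counit := by
  rw [twist_counit, ← BraidedCategory.braiding_naturality_left_assoc, Iso.hom_inv_id_assoc]

/-- The inverse of `κ.twist p`. -/
def twistInv (κ : DualIso C) (p : C) : p ⟶ p :=
  lCurry (prepDual p).unit
    ((κ.app p).inv ▷ p ≫ (β_ (perp p) p).hom ≫ (perpDual p).counit)

lemma twistInv_counit (κ : DualIso C) (p : C) :
    prep p ◁ κ.twistInv p ≫ (prepDual p).counit =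
      (κ.app p).inv ▷ p ≫ (β_ (perp p) p).hom ≫ (perpDual p).counit :=
  (prepDual p).whiskerLeft_lCurry _

/-- Under the pairing, `f` is traded for `perpMap f`, naturality of `κ` turns this into `prepMap f`,
and the pairing with `prep` turns it back into `f`. -/
lemma twist_naturality (κ : DualIso C) {p q : C} (f : p ⟶ q) :
    f ≫ κ.twist q = κ.twist p ≫ f := by
  apply (perpDual q).whiskerRight_ext
  rw [← cancel_epi (β_ (perp q) p).hom, comp_whiskerRight_assoc, comp_whiskerRight_assoc,
    ← perpMap_counit f, ← whisker_exchange_assoc,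
    ← BraidedCategory.braiding_naturality_left_assoc, braiding_twist_counit,
    ← BraidedCategory.braiding_naturality_right_assoc, braiding_twist_counit,
    ← comp_whiskerRight_assoc, κ.naturality, comp_whiskerRight_assoc, prepMap_counit,
    whisker_exchange_assoc]

/-- The automorphism of the identity functor with components `κ.twist`. -/
def twistIso (κ : DualIso C) : 𝟭 C ≅ 𝟭 C :=
  NatIso.ofComponents
    (fun p =>
      { hom := κ.twist p
        inv := κ.twistInv p
        hom_inv_id := by
          apply (prepDual p).whiskerLeft_ext
          dsimp only [Functor.id_obj]
          rw [MonoidalCategory.whiskerLeft_comp_assoc, twistInv_counit, whisker_exchange_assoc,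
            BraidedCategory.braiding_naturality_right_assoc, braiding_twist_counit]
          simp
        inv_hom_id := by
          apply (perpDual p).whiskerRight_ext
          dsimp only [Functor.id_obj]
          rw [comp_whiskerRight_assoc, twist_counit, ← whisker_exchange_assoc,
            BraidedCategory.braiding_inv_naturality_left_assoc, twistInv_counit]
          simp })
    (fun f => κ.twist_naturality f)

/-- The natural isomorphism from right to left duals that corresponds to an automorphism of the
identity functor. -/
def ofIdIso (θ : 𝟭 C ≅ 𝟭 C) : DualIso C where
  app p :=
    { hom := rCurry (prepDual p).unit
        ((β_ (perp p) p).hom ≫ idApp θ p ▷ perp p ≫ (perpDual p).counit)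
      inv := lCurry (perpDual p).unit
        (idApp θ.symm p ▷ prep p ≫ (β_ (prep p) p).inv ≫ (prepDual p).counit)
      hom_inv_id := by
        apply (perpDual p).whiskerLeft_ext
        rw [MonoidalCategory.whiskerLeft_comp_assoc, LinearDual.whiskerLeft_lCurry,
          whisker_exchange_assoc, BraidedCategory.braiding_inv_naturality_right_assoc,
          LinearDual.rCurry_whiskerRight]
        simp [← comp_whiskerRight_assoc]
      inv_hom_id := by
        apply (prepDual p).whiskerRight_ext
        rw [comp_whiskerRight_assoc, LinearDual.rCurry_whiskerRight,
          BraidedCategory.braiding_naturality_left_assoc, whisker_exchange_assoc,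
          LinearDual.whiskerLeft_lCurry]
        simp [← MonoidalCategory.whiskerLeft_comp_assoc] }
  naturality {p q} f := by
    apply (prepDual p).whiskerRight_ext
    dsimp only
    rw [comp_whiskerRight_assoc, LinearDual.rCurry_whiskerRight,
      BraidedCategory.braiding_naturality_left_assoc, whisker_exchange_assoc, perpMap_counit,
      comp_whiskerRight_assoc, prepMap_counit, ← whisker_exchange_assoc,
      LinearDual.rCurry_whiskerRight, BraidedCategory.braiding_naturality_right_assoc,
      ← comp_whiskerRight_assoc, ← comp_whiskerRight_assoc, idApp_naturality]

lemma braiding_idApp_counit (θ : 𝟭 C ≅ 𝟭 C) (p : C) :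
    ((ofIdIso θ).app p).hom ▷ p ≫ (prepDual p).counit =
      (β_ (perp p) p).hom ≫ idApp θ p ▷ perp p ≫ (perpDual p).counit :=
  (prepDual p).rCurry_whiskerRight _

variable (C) in
/-- Natural isomorphisms from right to left duals correspond to automorphisms of the identity
functor. -/
def equivIdIso : DualIso C ≃ (𝟭 C ≅ 𝟭 C) where
  toFun := twistIso
  invFun := ofIdIso
  left_inv κ := by
    ext p
    apply (prepDual p).whiskerRight_ext
    rw [braiding_idApp_counit, ← braiding_twist_counit]
    rfl
  right_inv θ := by
    ext p
    change (ofIdIso θ).twist p = idApp θ p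
    apply (perpDual p).whiskerRight_ext
    rw [← cancel_epi (β_ (perp p) p).hom, braiding_twist_counit, braiding_idApp_counit]

/-- Naturality of the braiding carries the curried `ω` to the right of `p`, where the counit undoes
the currying. -/
lemma cyc_ofIdIso (θ : 𝟭 C ≅ 𝟭 C) {p t : C} (ω : p ⊗ t ⟶ parUnit C) :
    (ofIdIso θ).cyc ω = (β_ t p).hom ≫ idApp θ p ▷ t ≫ ω := by
  rw [cyc, comp_whiskerRight_assoc, braiding_idApp_counit,
    BraidedCategory.braiding_naturality_left_assoc, whisker_exchange_assoc,
    LinearDual.whiskerLeft_lCurry]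

/-- Paired with `p ⊗ q`, the two sides of the semicycle equation become the two sides of the
semibalance equation, inside one and the same injective expression. -/
lemma isTensorSemicycle_ofIdIso_iff (θ : 𝟭 C ≅ 𝟭 C) :
    (ofIdIso θ).IsTensorSemicycle ↔ IsTensorSemibalance θ := by
  refine forall₂_congr fun p q => ?_
  change _ ↔ idApp θ (p ⊗ q) = (β_ p q).hom ≫ (idApp θ q ⊗ₘ idApp θ p) ≫ (β_ q p).hom
  have hl : ((ofIdIso θ).app (p ⊗ q)).hom ▷ (p ⊗ q) ≫ prepTensor p q ▷ (p ⊗ q) ≫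
      parCup (prepDual q).counit (prepDual p).counit =
      perpTensor p q ▷ (p ⊗ q) ≫ (β_ (perp q ⅋ perp p) (p ⊗ q)).hom ≫
        idApp θ (p ⊗ q) ▷ (perp q ⅋ perp p) ≫
          tensorCup (perpDual p).counit (perpDual q).counit := by
    rw [prepTensor_counit, braiding_idApp_counit, BraidedCategory.braiding_naturality_left_assoc,
      whisker_exchange_assoc, perpTensor_counit]
  have hr : (((ofIdIso θ).app q).hom ⅋ₘ ((ofIdIso θ).app p).hom) ▷ (p ⊗ q) ≫
      parCup (prepDual q).counit (prepDual p).counit =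
      (β_ (perp q ⅋ perp p) (p ⊗ q)).hom ≫
        ((β_ p q).hom ≫ (idApp θ q ⊗ₘ idApp θ p) ≫ (β_ q p).hom) ▷ (perp q ⅋ perp p) ≫
          tensorCup (perpDual p).counit (perpDual q).counit := by
    -- The double braiding comes out ahead of `θ_p ⊗ θ_q`; naturality moves its second half behind,
    -- swapping the factors.
    rw [parCup_naturality, braiding_idApp_counit, braiding_idApp_counit, parCup_braiding,
      ← tensorCup_naturality, ← comp_whiskerRight_assoc, Category.assoc,
      ← BraidedCategory.braiding_naturality]
  constructor
  · intro h
    have h' := congrArg (fun f => f ▷ (p ⊗ q) ≫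
      parCup (prepDual q).counit (prepDual p).counit) h
    simp only [comp_whiskerRight, Category.assoc, hl] at h'
    rw [hr, cancel_epi, cancel_epi] at h'
    exact ((perpDual p).tensor (perpDual q)).whiskerRight_ext h'
  · intro h
    apply ((prepDual q).par (prepDual p)).whiskerRight_ext
    rw [LinearDual.par, comp_whiskerRight_assoc, comp_whiskerRight_assoc, hl, hr, h]

/-- Both par braidings are traded for braidings of the duals, and each `θ` for its `perpMap`, so
that naturality of the tensor braiding applies. The result has the shape produced by
`tensorCup_braiding`. -/
lemma parHom_idApp_counit (θ : 𝟭 C ≅ 𝟭 C) (p q : C) :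
    (parBraiding p q ≫ (idApp θ q ⅋ₘ idApp θ p) ≫ parBraiding q p) ▷ (perp q ⊗ perp p) ≫
      parCup (perpDual p).counit (perpDual q).counit =
    (p ⅋ q) ◁ ((β_ (perp q) (perp p)).hom ≫ (β_ (perp p) (perp q)).hom) ≫
      parCup (idApp θ p ▷ perp p ≫ (perpDual p).counit)
        (idApp θ q ▷ perp q ≫ (perpDual q).counit) := by
  rw [comp_whiskerRight_assoc, comp_whiskerRight_assoc, parBraiding_counit,
    ← whisker_exchange_assoc, parCup_naturality, ← perpMap_counit, ← perpMap_counit,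
    ← parCup_whiskerLeft, ← whisker_exchange_assoc, ← whisker_exchange_assoc,
    parBraiding_counit, ← parCup_whiskerLeft]
  simp only [← MonoidalCategory.whiskerLeft_comp_assoc, Category.assoc]
  rw [BraidedCategory.braiding_naturality]

lemma isParSemicycle_ofIdIso_iff (θ : 𝟭 C ≅ 𝟭 C) :
    (ofIdIso θ).IsParSemicycle ↔ IsParSemibalance θ := by
  refine forall₂_congr fun p q => ?_
  change _ ↔ idApp θ (p ⅋ q) = parBraiding p q ≫ (idApp θ q ⅋ₘ idApp θ p) ≫ parBraiding q p
  have hl : ((ofIdIso θ).app (p ⅋ q)).hom ▷ (p ⅋ q) ≫ prepPar p q ▷ (p ⅋ q) ≫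
      tensorCup (prepDual q).counit (prepDual p).counit =
      perpPar p q ▷ (p ⅋ q) ≫ (β_ (perp q ⊗ perp p) (p ⅋ q)).hom ≫
        idApp θ (p ⅋ q) ▷ (perp q ⊗ perp p) ≫
          parCup (perpDual p).counit (perpDual q).counit := by
    rw [prepPar_counit, braiding_idApp_counit, BraidedCategory.braiding_naturality_left_assoc,
      whisker_exchange_assoc, perpPar_counit]
  have hr : (((ofIdIso θ).app q).hom ⊗ₘ ((ofIdIso θ).app p).hom) ▷ (p ⅋ q) ≫
      tensorCup (prepDual q).counit (prepDual p).counit =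
      (β_ (perp q ⊗ perp p) (p ⅋ q)).hom ≫
        (parBraiding p q ≫ (idApp θ q ⅋ₘ idApp θ p) ≫ parBraiding q p) ▷ (perp q ⊗ perp p) ≫
          parCup (perpDual p).counit (perpDual q).counit := by
    rw [tensorCup_naturality, braiding_idApp_counit, braiding_idApp_counit, tensorCup_braiding,
      parHom_idApp_counit]
  constructor
  · intro h
    have h' := congrArg (fun f => f ▷ (p ⅋ q) ≫
      tensorCup (prepDual q).counit (prepDual p).counit) h
    simp only [comp_whiskerRight, Category.assoc, hl] at h'
    rw [hr, cancel_epi, cancel_epi] at h'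
    exact ((perpDual p).par (perpDual q)).whiskerRight_ext h'
  · intro h
    apply ((prepDual q).tensor (prepDual p)).whiskerRight_ext
    rw [LinearDual.tensor, comp_whiskerRight_assoc, comp_whiskerRight_assoc, hl, hr, h]

end DualIso

end StarAut

/-- In a braided star-autonomous category, natural isomorphisms from right duals to left duals
correspond bijectively to automorphisms of the identity functor, by mutually inverse explicit
constructions, and this correspondence restricts to bijections between tensor-semicycles and
tensor-semibalances, between par-semicycles and par-semibalances, and between cycles and
balances. -/
theorem theorem4p2 {C : Type u} [Category.{v} C] [MonoidalCategory C] [BraidedCategory C]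
    [ParMonoidal C] [LinearlyDistributive C] [StarAutonomous C] :
    ∃ Φ : DualIso C ≃ (𝟭 C ≅ 𝟭 C),
      (∀ (κ : DualIso C) (p : C), (Φ κ).hom.app p = κ.twist p) ∧
      (∀ (θ : 𝟭 C ≅ 𝟭 C) (p t : C) (ω : p ⊗ t ⟶ parUnit C),
        (Φ.symm θ).cyc ω = (β_ t p).hom ≫ θ.hom.app p ▷ t ≫ ω) ∧
      Set.BijOn Φ {κ | κ.IsTensorSemicycle} {θ | IsTensorSemibalance θ} ∧
      Set.BijOn Φ {κ | κ.IsParSemicycle} {θ | IsParSemibalance θ} ∧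
      Set.BijOn Φ {κ | κ.IsCycle} {θ | IsBalance θ} := by
  have ht (κ : DualIso C) :
      κ.IsTensorSemicycle ↔ IsTensorSemibalance (DualIso.equivIdIso C κ) := by
    rw [← DualIso.isTensorSemicycle_ofIdIso_iff]
    -- The equivalences are proved for `ofIdIso θ`; every `κ` has this form, with `θ` its own twist.
    exact iff_of_eq (congrArg _ ((DualIso.equivIdIso C).symm_apply_apply κ).symm)
  have hp (κ : DualIso C) :
      κ.IsParSemicycle ↔ IsParSemibalance (DualIso.equivIdIso C κ) := by
    rw [← DualIso.isParSemicycle_ofIdIso_iff]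
    exact iff_of_eq (congrArg _ ((DualIso.equivIdIso C).symm_apply_apply κ).symm)
  exact ⟨DualIso.equivIdIso C, fun κ p => rfl, fun θ p t ω => DualIso.cyc_ofIdIso θ ω,
    (DualIso.equivIdIso C).bijOn fun κ => (ht κ).symm,
    (DualIso.equivIdIso C).bijOn fun κ => (hp κ).symm,
    (DualIso.equivIdIso C).bijOn fun κ =>
      (and_congr (ht κ) (hp κ)).symm⟩
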